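/- Let $G=(V,E)$ be an infinite, connected, vertex-transitive simple graph in which every vertex has degree $\Delta$, where $3\le\Delta<\infty$. Fix a vertex $o\in V$ and let $\sigma_n$ be the number of $n$-step self-avoiding walks on $G$ starting at $o$. Let $P$ be the transition matrix of simple random walk on $G$, so that $P(v,w)=1/\Delta$ if $v,w$ are adjacent and $P(v,w)=0$ otherwise. Then: 1. the limit $\mu(G):=\lim_{n\to\infty}\sigma_n^{1/n}$ (the connective constant) exists; 2. there is a largest real number $\lambda$ (the spectral bottom of $I-P$) such that $\langle f,(I-P)f\rangle\ge\lambda\langle f,f\rangle$ for all $f\in\ell^2(V)$; 3. $\displaystyle \mu(G)\ \ge\ (\Delta-1)^{\frac12(1+c\lambda)}$, where $\displaystyle c=\frac{\Delta(\Delta-1)}{(\Delta-2)^2}$; 4. $(\Delta-1)^{\frac12(1+c\lambda)}>\sqrt{\Delta-1}$ if and only if $G$ is non-amenable, that is, if and only if the edge-isoperimetric constant $$\phi(G):=\inf\left\{\frac{|\partial W|}{\Delta\,|W|}:\ W\subset V,\ 0<|W|<\infty\right\}$$ is non-zero, where $\partial W$ denotes the set of edges between $W$ and $V\setminus W$. 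-/

import Mathlib

noncomputable section

namespace SimpleGraph

variable {V : Type*} (G : SimpleGraph V)

/-- `G` is (vertex-)transitive: its automorphism group acts transitively on the vertices. -/
def IsVertexTransitive : Prop :=
  ∀ u v : V, ∃ α : G ≃g G, α u = v

/-- The set of `n`-step self-avoiding walks on `G` starting at `o`
(walks with `n` edges no vertex of which appears more than once). -/
def selfAvoidingWalks (o : V) (n : ℕ) : Set (Σ v : V, G.Walk o v) :=
  {p | p.2.IsPath ∧ p.2.length = n}

/-- The number `σ_n` of `n`-step self-avoiding walks starting at `o`. -/
def sawCount (o : V) (n : ℕ) : ℕ :=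
  (G.selfAvoidingWalks o n).ncard

/-- The connective constant `μ(G) = lim σ_n ^ (1 / n)`, computed at the origin `o`. -/
def connectiveConstant (o : V) : ℝ :=
  Filter.limUnder Filter.atTop (fun n : ℕ => (G.sawCount o n : ℝ) ^ (1 / (n : ℝ)))

/-- The action `f ↦ P f` on functions of the transition matrix `P` of simple random walk on `G`:
`P(v, w) = 1 / deg v` if `w` is a neighbour of `v`, and `P(v, w) = 0` otherwise. -/
def srwOperator [G.LocallyFinite] (f : V → ℝ) (v : V) : ℝ :=
  ∑ w ∈ G.neighborFinset v, (1 / (G.degree v : ℝ)) * f w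

/-- The set of all `l` such that `⟨f, (I - P) f⟩ ≥ l ⟨f, f⟩` for every `f ∈ ℓ²(V)`. -/
def spectralLowerBounds [G.LocallyFinite] : Set ℝ :=
  {l | ∀ f : V → ℝ, Memℓp f 2 →
    l * ∑' v, f v * f v ≤ ∑' v, f v * (f v - G.srwOperator f v)}

/-- The spectral bottom of `I - P`: the largest `l` such that
`⟨f, (I - P) f⟩ ≥ l ⟨f, f⟩` for every `f ∈ ℓ²(V)`. -/
def spectralBottom [G.LocallyFinite] : ℝ :=
  sSup G.spectralLowerBounds

/-- The set of edges between `W` and its complement. -/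
def edgesToCompl (W : Set V) : Set (Sym2 V) :=
  {e | ∃ u ∈ W, ∃ v ∉ W, G.Adj u v ∧ e = s(u, v)}

/-- The edge-isoperimetric constant of a `Δ`-regular graph: the infimum of `|∂W| / (Δ |W|)`
over all finite non-empty sets `W` of vertices. -/
def edgeIsoperimetricConstant (Δ : ℕ) : ℝ :=
  ⨅ W : {W : Finset V // W.Nonempty},
    ((G.edgesToCompl (W.1 : Set V)).ncard : ℝ) / ((Δ : ℝ) * (W.1.card : ℝ))

/-- A `Δ`-regular graph is amenable if its edge-isoperimetric constant is zero. -/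
def IsAmenableOfDegree (Δ : ℕ) : Prop :=
  G.edgeIsoperimetricConstant Δ = 0

end SimpleGraph

end

/-! ### Edge cuts of finite sets and the filling of enclosed regions -/

noncomputable section

namespace SimpleGraph

open Finset

/-! Self-avoiding walks are grown step by step without ever entering a region cut off from infinity.
Let `W` consist of the visited vertices and the finite regions enclosed so far, let `x` be the next
vertex, and let `W'` be `W` with `x` and all that it encloses. Edges from `U = W' \ W` that leave
`W'` start at `x`. If there are `d` of them, then `d ≥ 1`, so the walk is never trapped, and
counting edges gives `|∂W'| = |∂W| + 2d - |∂U|`.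

By uncrossing minimal cuts, transitivity forces `|∂U| ≥ Δ` (`le_cutSize`). Summing over a walk with
`n` vertices and branching numbers `d_i` yields `|∂W| + Δ n ≤ 2 ∑ d_i`, where now `W` is the final
filled set. Testing the spectral bound on functions that decay geometrically away from `W` gives
`|∂W| ≥ λ Δ(Δ-1)/(Δ-2) |W|` (`mul_card_le_cutSize`), and `|W| ≥ n`. Hence non-amenability raises the
average branching number.

Concavity gives `d ≥ (Δ-1)^((d-1)/(Δ-2))` for `1 ≤ d ≤ Δ-1`. So, up to a constant factor, the
product of the `d_i` along every such walk is at least `(Δ-1)^(n(1+cλ)/2)`. Choosing each step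
uniformly gives every walk the inverse of such a product as its probability; these add up to one, so
there are at least that many walks.

The limit exists by submultiplicativity. Positivity of `λ` is equivalent to non-amenability by the
isoperimetric bound above in one direction and Cheeger's inequality in the other. -/

/-- In an infinite connected graph every finite non-empty set has an outgoing edge. -/
theorem Connected.exists_adj_notMem {V : Type*} [Infinite V] {G : SimpleGraph V}
    (hconn : G.Connected) {U : Finset V} (hU : U.Nonempty) : ∃ u ∈ U, ∃ v ∉ U, G.Adj u v := by
  obtain ⟨u, hu⟩ := hU
  obtain ⟨v, hv⟩ := Infinite.exists_notMem_finset U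
  obtain ⟨p⟩ := hconn.preconnected u v
  obtain ⟨d, _, h1, h2⟩ := p.exists_boundary_dart (U : Set V) hu hv
  exact ⟨d.fst, h1, d.snd, h2, d.adj⟩

theorem apply_mem_map_iff {V : Type*} {G : SimpleGraph V} (α : G ≃g G) (W : Finset V) (v : V) :
    α v ∈ W.map α.toEquiv.toEmbedding ↔ v ∈ W :=
  mem_map' α.toEquiv.toEmbedding

/-- A finite set `W` is saturated if its complement has no finite union of components. -/
def Saturated {V : Type*} [DecidableEq V] (G : SimpleGraph V) (W : Finset V) : Prop :=
  ∀ U : Finset V, U.Nonempty → Disjoint W U → ∃ u ∈ U, ∃ v ∉ W ∪ U, G.Adj u v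

theorem saturated_empty {V : Type*} [DecidableEq V] [Infinite V] (G : SimpleGraph V)
    (hconn : G.Connected) : G.Saturated ∅ := by
  intro U hU _
  simpa using hconn.exists_adj_notMem hU

variable {V : Type*} [DecidableEq V] (G : SimpleGraph V) [G.LocallyFinite]

/-- The number of edges between a finite set of vertices and its complement. -/
def cutSize (W : Finset V) : ℕ :=
  ∑ u ∈ W, #(G.neighborFinset u \ W)

/-- The number of pairs of adjacent vertices `(u, v)` with `u ∈ X` and `v ∈ Y`. -/
def adjPairs (X Y : Finset V) : ℕ :=
  ∑ u ∈ X, #(G.neighborFinset u ∩ Y)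

theorem ncard_edgesToCompl (W : Finset V) :
    (G.edgesToCompl (W : Set V)).ncard = G.cutSize W := by
  have h : G.edgesToCompl (W : Set V) =
      ((W.sigma fun u => G.neighborFinset u \ W).image fun p => s(p.1, p.2) : Finset (Sym2 V)) := by
    ext e
    simp only [edgesToCompl, Set.mem_ofPred_eq, coe_image, Set.mem_image, mem_coe, mem_sigma,
      mem_sdiff, mem_neighborFinset, Sigma.exists]
    constructor
    · rintro ⟨u, hu, v, hv, ha, rfl⟩
      exact ⟨u, v, ⟨hu, ha, hv⟩, rfl⟩
    · rintro ⟨u, v, ⟨hu, ha, hv⟩, rfl⟩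
      exact ⟨u, hu, v, hv, ha, rfl⟩
  rw [h, Set.ncard_coe_finset, card_image_of_injOn, card_sigma, cutSize]
  rintro ⟨u, v⟩ hp ⟨u', v'⟩ hq he
  simp only [coe_sigma, Set.mem_sigma_iff, mem_coe, mem_sdiff, mem_neighborFinset] at hp hq
  simp only [Sym2.eq_iff] at he
  rcases he with ⟨rfl, rfl⟩ | ⟨rfl, rfl⟩
  · rfl
  · exact absurd hp.1 hq.2.2

theorem adjPairs_comm (X Y : Finset V) : G.adjPairs X Y = G.adjPairs Y X := by
  have h : ∀ X Y : Finset V,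
      G.adjPairs X Y = ∑ u ∈ X, ∑ v ∈ Y, if v ∈ G.neighborFinset u then 1 else 0 := by
    intro X Y
    refine sum_congr rfl fun u _ => ?_
    rw [← sum_filter, card_eq_sum_ones, inter_comm, filter_mem_eq_inter]
  rw [h, h, sum_comm]
  refine sum_congr rfl fun u _ => sum_congr rfl fun v _ => ?_
  exact if_congr (by rw [mem_neighborFinset, mem_neighborFinset, G.adj_comm]) rfl rfl

theorem cutSize_eq_add {W U : Finset V} (h : Disjoint W U) :
    G.cutSize W = ∑ u ∈ W, #(G.neighborFinset u \ (W ∪ U)) + G.adjPairs W U := by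
  rw [cutSize, adjPairs, ← sum_add_distrib]
  refine sum_congr rfl fun u _ => ?_
  rw [← card_union_of_disjoint]
  · congr 1
    ext v
    have : v ∈ U → v ∉ W := fun hv => Finset.disjoint_right.1 h hv
    simp only [mem_sdiff, mem_union, mem_inter]
    tauto
  · rw [Finset.disjoint_left]
    simp only [mem_sdiff, mem_union, mem_inter]
    tauto

theorem cutSize_union_add {W U : Finset V} (h : Disjoint W U) :
    G.cutSize (W ∪ U) + 2 * G.adjPairs U W = G.cutSize W + G.cutSize U := by
  rw [G.cutSize_eq_add h, G.cutSize_eq_add h.symm, union_comm U W, G.adjPairs_comm W U,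
    cutSize, sum_union h]
  ring

/-- Submodularity holds vertex by vertex. A vertex of both sets contributes equally to the two sides
by inclusion-exclusion; a vertex of just one set contributes no more on the left, because the union
leaves fewer neighbours outside. -/
theorem cutSize_inter_add_cutSize_union_le (A B : Finset V) :
    G.cutSize (A ∩ B) + G.cutSize (A ∪ B) ≤ G.cutSize A + G.cutSize B := by
  have h : ∀ X : Finset V, X ⊆ A ∪ B →
      G.cutSize X = ∑ u ∈ A ∪ B, if u ∈ X then #(G.neighborFinset u \ X) else 0 := by
    intro X hX
    rw [← sum_filter, filter_mem_eq_inter, inter_eq_right.2 hX, cutSize]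
  rw [h _ (inter_subset_left.trans subset_union_left), h _ subset_rfl, h _ subset_union_left,
    h _ subset_union_right, ← sum_add_distrib, ← sum_add_distrib]
  refine sum_le_sum fun u hu => ?_
  have hA : #(G.neighborFinset u \ (A ∪ B)) ≤ #(G.neighborFinset u \ A) :=
    card_le_card (sdiff_subset_sdiff subset_rfl subset_union_left)
  have hB : #(G.neighborFinset u \ (A ∪ B)) ≤ #(G.neighborFinset u \ B) :=
    card_le_card (sdiff_subset_sdiff subset_rfl subset_union_right)
  have hAB : #(G.neighborFinset u \ (A ∩ B)) + #(G.neighborFinset u \ (A ∪ B)) =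
      #(G.neighborFinset u \ A) + #(G.neighborFinset u \ B) := by
    rw [sdiff_inter_distrib_right, sdiff_union_distrib, card_union_add_card_inter]
  by_cases h1 : u ∈ A <;> by_cases h2 : u ∈ B <;> simp_all

theorem cutSize_pos_iff {W : Finset V} :
    0 < G.cutSize W ↔ ∃ u ∈ W, ∃ v ∉ W, G.Adj u v := by
  rw [cutSize, sum_pos_iff]
  simp only [card_pos, Finset.Nonempty, mem_sdiff, mem_neighborFinset]
  exact exists_congr fun u => and_congr_right fun _ => exists_congr fun v => and_comm

theorem cutSize_map (α : G ≃g G) (W : Finset V) :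
    G.cutSize (W.map α.toEquiv.toEmbedding) = G.cutSize W := by
  rw [cutSize, cutSize, sum_map]
  refine sum_congr rfl fun u _ => ?_
  refine Eq.trans ?_ (card_map α.toEquiv.toEmbedding)
  congr 1
  ext v
  obtain ⟨v, rfl⟩ := α.surjective v
  change α v ∈ G.neighborFinset (α u) \ _ ↔ _
  rw [apply_mem_map_iff, mem_sdiff, mem_sdiff, apply_mem_map_iff, mem_neighborFinset,
    mem_neighborFinset, α.map_adj_iff]

/-- The minimal edge cuts around finite sets of a vertex-transitive graph have at least as many
edges as there are at a vertex. -/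
theorem le_cutSize [Infinite V] (hconn : G.Connected) (htrans : G.IsVertexTransitive) {Δ : ℕ}
    (hreg : G.IsRegularOfDegree Δ) {W : Finset V} (hW : W.Nonempty) : Δ ≤ G.cutSize W := by
  obtain ⟨B, hB, hBmin⟩ := WellFounded.has_min (measure G.cutSize).wf
    {W : Finset V | W.Nonempty} ⟨W, hW⟩
  replace hBmin : ∀ X : Finset V, X.Nonempty → G.cutSize B ≤ G.cutSize X :=
    fun X hX => not_lt.1 (hBmin X hX)
  obtain ⟨A, ⟨hA, hAB⟩, hAmin⟩ := WellFounded.has_min (measure (Finset.card (α := V))).wf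
    {W : Finset V | W.Nonempty ∧ G.cutSize W = G.cutSize B} ⟨B, hB, rfl⟩
  replace hAmin : ∀ X : Finset V, X.Nonempty → G.cutSize X = G.cutSize A → #A ≤ #X :=
    fun X hX h => not_lt.1 (hAmin X ⟨hX, h.trans hAB⟩)
  rw [← hAB] at hBmin
  refine le_trans ?_ (hBmin W hW)
  have hpos : 0 < G.cutSize A := G.cutSize_pos_iff.2 (hconn.exists_adj_notMem hA)
  -- Uncrossing: if a translate meets `A`, submodularity makes the intersection a minimal cut too,
  -- and the minimal cardinality of `A` forces the translate to equal `A`. So translates of `A` are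
  -- equal or disjoint, and all vertices of `A` have the same number of neighbours outside.
  have hblock : ∀ α : G ≃g G, (A ∩ A.map α.toEquiv.toEmbedding).Nonempty →
      A.map α.toEquiv.toEmbedding = A := by
    intro α hne
    have h1 := G.cutSize_inter_add_cutSize_union_le A (A.map α.toEquiv.toEmbedding)
    rw [G.cutSize_map] at h1
    have h2 := hBmin _ hne
    have h3 := hBmin _ (hA.mono (subset_union_left (s₂ := A.map α.toEquiv.toEmbedding)))
    have h4 := hAmin _ hne (by omega)
    have h5 := eq_of_subset_of_card_le inter_subset_left h4
    exact (eq_of_subset_of_card_le (inter_eq_left.1 h5) (by simp)).symm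
  obtain ⟨a, ha⟩ := hA
  have hdeg : ∀ u ∈ A, #(G.neighborFinset u \ A) = #(G.neighborFinset a \ A) := by
    intro u hu
    obtain ⟨α, hα⟩ := htrans a u
    have hAα := hblock α ⟨u, mem_inter.2 ⟨hu, mem_map.2 ⟨a, ha, hα⟩⟩⟩
    refine Eq.trans ?_ (card_map α.toEquiv.toEmbedding)
    congr 1
    ext v
    obtain ⟨v, rfl⟩ := α.surjective v
    have hv : α v ∈ A ↔ v ∈ A := by
      rw [← apply_mem_map_iff α A v, hAα]
    subst hα
    rw [apply_mem_map_iff, mem_sdiff, mem_sdiff, hv, mem_neighborFinset, mem_neighborFinset,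
      α.map_adj_iff]
  have hcut : G.cutSize A = #A * #(G.neighborFinset a \ A) := by
    rw [cutSize, sum_congr rfl hdeg, sum_const, smul_eq_mul]
  have hsum : #(G.neighborFinset a \ A) + #(G.neighborFinset a ∩ A) = Δ := by
    rw [card_sdiff_add_card_inter, card_neighborFinset_eq_degree, hreg a]
  have hlt : #(G.neighborFinset a ∩ A) < #A := by
    refine card_lt_card ⟨inter_subset_right, fun h => ?_⟩
    simpa using (mem_inter.1 (h ha)).1
  rw [hcut] at hpos ⊢
  have h1 : 0 < #(G.neighborFinset a \ A) := Nat.pos_of_mul_pos_left hpos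
  calc Δ = #(G.neighborFinset a \ A) + #(G.neighborFinset a ∩ A) := hsum.symm
    -- With `m` neighbours inside and `k ≥ 1` outside, `k + m ≤ (m + 1) k`.
    _ ≤ (#(G.neighborFinset a ∩ A) + 1) * #(G.neighborFinset a \ A) := by nlinarith
    _ ≤ _ := Nat.mul_le_mul_right _ hlt

/-- `W` together with `x` and finitely many further vertices from which no edges leave. -/
structure IsFilling (W : Finset V) (x : V) (W' : Finset V) : Prop where
  subset : W ⊆ W'
  mem : x ∈ W'
  eq_of_adj : ∀ u ∈ W', u ∉ W → ∀ v ∉ W', G.Adj u v → u = x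

/-- A filling with the smallest cut is saturated: absorbing a finite set all of whose outgoing edges
lead back into the filling would remove those edges from the cut. -/
theorem exists_isFilling_saturated [Infinite V] (hconn : G.Connected) (W : Finset V) (x : V) :
    ∃ W', G.IsFilling W x W' ∧ G.Saturated W' := by
  obtain ⟨W', hW', hmin⟩ := WellFounded.has_min (measure G.cutSize).wf
    {W' | G.IsFilling W x W'} ⟨insert x W, subset_insert _ _, mem_insert_self _ _,
      fun u hu hu' _ _ _ => (mem_insert.1 hu).resolve_right hu'⟩
  refine ⟨W', hW', fun U hU hd => ?_⟩
  by_contra! hno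
  have hout : ∑ u ∈ U, #(G.neighborFinset u \ (U ∪ W')) = 0 := by
    refine sum_eq_zero fun u hu => ?_
    rw [card_eq_zero, sdiff_eq_empty_iff_subset]
    intro v hv
    by_contra h
    rw [union_comm] at h
    exact hno u hu v h (by simpa using hv)
  have h1 := G.cutSize_eq_add hd.symm
  have h2 := G.cutSize_union_add hd
  have h3 : 0 < G.cutSize U := G.cutSize_pos_iff.2 (hconn.exists_adj_notMem hU)
  refine hmin (W' ∪ U) ⟨hW'.subset.trans subset_union_left, mem_union_left _ hW'.mem, ?_⟩
    (show G.cutSize (W' ∪ U) < G.cutSize W' by omega)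
  intro u hu huW v hv huv
  rcases mem_union.1 hu with hu | hu
  · exact hW'.eq_of_adj u hu huW v (fun h => hv (mem_union_left _ h)) huv
  · exact absurd huv (hno u hu v hv)

/-- For `U = W' \ W`, every edge of `∂U` either leads to `W` or leaves `W'` from `x`. Eliminating
the edges between `U` and `W` leaves `|∂U|` with a negative sign, and `le_cutSize` bounds it below
by `Δ`. -/
theorem IsFilling.cutSize_add_le [Infinite V] {G : SimpleGraph V} [G.LocallyFinite]
    (hconn : G.Connected) (htrans : G.IsVertexTransitive) {Δ : ℕ} (hreg : G.IsRegularOfDegree Δ)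
    {W W' : Finset V} {x : V} (h : G.IsFilling W x W') (hx : x ∉ W) :
    G.cutSize W' + Δ ≤ G.cutSize W + 2 * #(G.neighborFinset x \ W') := by
  have hd : Disjoint W (W' \ W) := disjoint_sdiff
  have hu : W ∪ W' \ W = W' := union_sdiff_of_subset h.subset
  have hxU : x ∈ W' \ W := mem_sdiff.2 ⟨h.mem, hx⟩
  have h1 := G.cutSize_union_add hd
  have h2 := G.cutSize_eq_add hd.symm
  rw [hu] at h1
  rw [union_comm, hu, sum_eq_single_of_mem x hxU] at h2
  · have := G.le_cutSize hconn htrans hreg ⟨x, hxU⟩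
    omega
  · intro u hu hux
    rw [card_eq_zero, sdiff_eq_empty_iff_subset]
    intro v hv
    by_contra hvW
    rw [mem_sdiff] at hu
    exact hux (h.eq_of_adj u hu.1 hu.2 v hvW (by simpa using hv))

/-- This keeps the walk from being trapped: saturation of `W` provides an edge from `W' \ W` out of
`W'`, and such an edge must start at `x`. -/
theorem IsFilling.nonempty {G : SimpleGraph V} [G.LocallyFinite] {W W' : Finset V} {x : V}
    (h : G.IsFilling W x W') (hx : x ∉ W) (hW : G.Saturated W) :
    (G.neighborFinset x \ W').Nonempty := by
  have hxU : x ∈ W' \ W := mem_sdiff.2 ⟨h.mem, hx⟩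
  obtain ⟨u, hu, v, hv, huv⟩ := hW (W' \ W) ⟨x, hxU⟩ disjoint_sdiff
  rw [union_sdiff_of_subset h.subset] at hv
  rw [mem_sdiff] at hu
  obtain rfl := h.eq_of_adj u hu.1 hu.2 v hv huv
  exact ⟨v, by simp [huv, hv]⟩

end SimpleGraph

end

/-! ### The Dirichlet form, Cheeger's inequality and the improved isoperimetric bound -/

noncomputable section

namespace SimpleGraph

open Finset Filter Topology

theorem srwOperator_eq {V : Type*} (G : SimpleGraph V) [G.LocallyFinite] {Δ : ℕ}
    (hreg : G.IsRegularOfDegree Δ) (f : V → ℝ) (v : V) :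
    G.srwOperator f v = (∑ w ∈ G.neighborFinset v, f w) / Δ := by
  rw [srwOperator, ← mul_sum, hreg v]
  ring

variable {V : Type*} [DecidableEq V] (G : SimpleGraph V) [G.LocallyFinite]

/-- Reversing ordered adjacent pairs inside `T`; the support condition discards the pairs that cross
the border of `T`. -/
theorem sum_neighborFinset_swap (T : Finset V) (k : V → V → ℝ)
    (hk : ∀ v w, G.Adj v w → ¬ (v ∈ T ∧ w ∈ T) → k v w = 0) :
    ∑ v ∈ T, ∑ w ∈ G.neighborFinset v, k v w = ∑ v ∈ T, ∑ w ∈ G.neighborFinset v, k w v := by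
  have h : ∀ k : V → V → ℝ, (∀ v w, G.Adj v w → ¬ (v ∈ T ∧ w ∈ T) → k v w = 0) →
      ∑ v ∈ T, ∑ w ∈ G.neighborFinset v, k v w =
        ∑ v ∈ T, ∑ w ∈ T, if w ∈ G.neighborFinset v then k v w else 0 := by
    intro k hk
    refine sum_congr rfl fun v _ => ?_
    rw [← sum_filter, filter_mem_eq_inter]
    refine (sum_subset inter_subset_right fun w hw hwT => ?_).symm
    exact hk v w (by simpa using hw) fun h => hwT (mem_inter.2 ⟨h.2, hw⟩)
  rw [h k hk, h (fun v w => k w v) fun v w hvw hT => hk w v hvw.symm fun h => hT h.symm, sum_comm]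
  refine sum_congr rfl fun u _ => sum_congr rfl fun v _ => ?_
  exact if_congr (by rw [mem_neighborFinset, mem_neighborFinset, G.adj_comm]) rfl rfl

/-- The set of vertices at distance at most one from `S`. -/
def closedNbhd (S : Finset V) : Finset V :=
  S ∪ S.biUnion fun v => G.neighborFinset v

theorem subset_closedNbhd (S : Finset V) : S ⊆ G.closedNbhd S :=
  subset_union_left

variable {G} in
theorem mem_closedNbhd_of_adj {S : Finset V} {v w : V} (hv : v ∈ S) (h : G.Adj v w) :
    w ∈ G.closedNbhd S :=
  mem_union_right _ (mem_biUnion.2 ⟨v, hv, by simpa using h⟩)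

theorem sum_sum_neighborFinset {Δ : ℕ} (hreg : G.IsRegularOfDegree Δ) {S T : Finset V}
    (hT : G.closedNbhd S ⊆ T) {h : V → ℝ} (hS : ∀ v ∉ S, h v = 0) :
    ∑ v ∈ T, ∑ w ∈ G.neighborFinset v, h w = Δ * ∑ v ∈ T, h v := by
  rw [G.sum_neighborFinset_swap T (fun _ w => h w), mul_sum]
  · refine sum_congr rfl fun v _ => ?_
    rw [sum_const, card_neighborFinset_eq_degree, hreg v, nsmul_eq_mul]
  · intro v w hvw hvT
    refine hS w fun hw => hvT ⟨hT (mem_closedNbhd_of_adj hw hvw.symm), ?_⟩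
    exact hT (G.subset_closedNbhd S hw)

/-- Expand the square. The factor `2` appears because each edge is counted in both directions. -/
theorem sum_sq_sub_eq {Δ : ℕ} (hreg : G.IsRegularOfDegree Δ) (hΔ : Δ ≠ 0) {S T : Finset V}
    (hT : G.closedNbhd S ⊆ T) {f : V → ℝ} (hS : ∀ v ∉ S, f v = 0) :
    ∑ v ∈ T, ∑ w ∈ G.neighborFinset v, (f v - f w) ^ 2 =
      2 * Δ * ∑' v, f v * (f v - G.srwOperator f v) := by
  have hTf : ∀ v ∉ T, f v = 0 := fun v hv => hS v fun h => hv (hT (G.subset_closedNbhd S h))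
  rw [tsum_eq_sum (s := T) fun v hv => by rw [hTf v hv, zero_mul]]
  have h1 : ∀ v, ∑ w ∈ G.neighborFinset v, (f v - f w) ^ 2 =
      Δ * f v ^ 2 - 2 * (Δ * (f v * G.srwOperator f v)) + ∑ w ∈ G.neighborFinset v, f w ^ 2 := by
    intro v
    have hΔ' : (Δ : ℝ) ≠ 0 := by exact_mod_cast hΔ
    have h2 : (Δ : ℝ) * (f v * G.srwOperator f v) = ∑ w ∈ G.neighborFinset v, f v * f w := by
      rw [G.srwOperator_eq hreg, ← mul_sum]
      field_simp
    have h3 : (Δ : ℝ) * f v ^ 2 = ∑ w ∈ G.neighborFinset v, f v ^ 2 := by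
      rw [sum_const, card_neighborFinset_eq_degree, hreg v, nsmul_eq_mul]
    rw [h2, h3, mul_sum, ← sum_sub_distrib, ← sum_add_distrib]
    exact sum_congr rfl fun w _ => by ring
  rw [sum_congr rfl fun v _ => h1 v, sum_add_distrib,
    G.sum_sum_neighborFinset hreg hT (h := fun v => f v ^ 2) fun v hv => by simp [hS v hv],
    mul_sum, mul_sum, ← sum_add_distrib]
  exact sum_congr rfl fun v _ => by ring

theorem sum_sq_add_le {Δ : ℕ} (hreg : G.IsRegularOfDegree Δ) {S T : Finset V}
    (hT : G.closedNbhd S ⊆ T) {f : V → ℝ} (hS : ∀ v ∉ S, f v = 0) :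
    ∑ v ∈ T, ∑ w ∈ G.neighborFinset v, (f v + f w) ^ 2 ≤ 4 * Δ * ∑ v ∈ T, f v * f v := by
  calc ∑ v ∈ T, ∑ w ∈ G.neighborFinset v, (f v + f w) ^ 2
      ≤ ∑ v ∈ T, ∑ w ∈ G.neighborFinset v, (2 * f v ^ 2 + 2 * f w ^ 2) :=
        sum_le_sum fun v _ => sum_le_sum fun w _ => by nlinarith [sq_nonneg (f v - f w)]
    _ = ∑ v ∈ T, (Δ * (2 * f v ^ 2)) + ∑ v ∈ T, ∑ w ∈ G.neighborFinset v, 2 * f w ^ 2 := by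
        rw [← sum_add_distrib]
        refine sum_congr rfl fun v _ => ?_
        rw [sum_add_distrib, sum_const, card_neighborFinset_eq_degree, hreg v, nsmul_eq_mul]
    _ = 4 * Δ * ∑ v ∈ T, f v * f v := by
        rw [G.sum_sum_neighborFinset hreg hT (h := fun v => 2 * f v ^ 2)
          fun v hv => by simp [hS v hv], mul_sum, mul_sum, ← sum_add_distrib]
        exact sum_congr rfl fun v _ => by ring

theorem sum_abs_sub_indicator {S T : Finset V} (hT : G.closedNbhd S ⊆ T) :
    ∑ v ∈ T, ∑ w ∈ G.neighborFinset v,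
      |(if v ∈ S then (1 : ℝ) else 0) - (if w ∈ S then 1 else 0)| = 2 * G.cutSize S := by
  have h1 : ∑ v ∈ T, ∑ w ∈ G.neighborFinset v, (if v ∈ S ∧ w ∉ S then (1 : ℝ) else 0) =
      G.cutSize S := by
    rw [cutSize, Nat.cast_sum,
      ← sum_subset ((G.subset_closedNbhd S).trans hT) fun v _ hv => sum_eq_zero fun w _ => by
        simp [hv]]
    refine sum_congr rfl fun v hv => ?_
    rw [sum_congr rfl fun w _ => if_congr (and_iff_right hv) rfl rfl, ← sum_filter, sum_const,
      nsmul_one, sdiff_eq_filter]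
  have h2 := G.sum_neighborFinset_swap T (fun v w => if v ∈ S ∧ w ∉ S then (1 : ℝ) else 0) (by
    intro v w hvw hn
    refine if_neg fun h => hn ⟨hT (G.subset_closedNbhd S h.1), hT (mem_closedNbhd_of_adj h.1 hvw)⟩)
  rw [two_mul]
  nth_rewrite 2 [← h1]
  rw [h2, ← h1, ← sum_add_distrib]
  refine sum_congr rfl fun v _ => ?_
  rw [← sum_add_distrib]
  refine sum_congr rfl fun w _ => ?_
  by_cases hv : v ∈ S <;> by_cases hw : w ∈ S <;> simp [hv, hw]

/-- The discrete co-area inequality. -/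
theorem coarea_le {Δ : ℕ} {φ : ℝ}
    (hφ : ∀ W : Finset V, W.Nonempty → φ * (Δ * #W) ≤ G.cutSize W) (T S : Finset V) :
    G.closedNbhd S ⊆ T → ∀ g : V → ℝ, (∀ v, 0 ≤ g v) → (∀ v ∉ S, g v = 0) →
    2 * φ * Δ * ∑ v ∈ T, g v ≤ ∑ v ∈ T, ∑ w ∈ G.neighborFinset v, |g v - g w| := by
  induction S using Finset.strongInduction with
  | H S ih =>
    intro hT g hg hS
    rcases S.eq_empty_or_nonempty with rfl | hne
    · have : ∀ v, g v = 0 := fun v => hS v (by simp)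
      simp [this]
    obtain ⟨a, ha, hmin⟩ := S.exists_min_image g hne
    -- Peel off the lowest layer: subtracting the minimum of `g` on `S` keeps `g` nonnegative and
    -- makes it vanish at `a`. Both sides of the inequality split additively, and the layer itself
    -- is the isoperimetric inequality for `S`.
    set g' : V → ℝ := fun v => g v - g a * (if v ∈ S then 1 else 0) with hg'
    have hsub : G.closedNbhd (S.erase a) ⊆ T :=
      (union_subset_union (erase_subset a S)
        (biUnion_subset_biUnion_of_subset_left _ (erase_subset a S))).trans hT
    have h1 := ih _ (erase_ssubset ha) hsub g'
      (by
        intro v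
        by_cases hv : v ∈ S
        · simpa [hg', hv] using hmin v hv
        · simpa [hg', hv] using hg v)
      (by
        intro v hv
        by_cases hva : v = a
        · subst hva
          simp [hg', ha]
        · have hvS : v ∉ S := fun h => hv (mem_erase.2 ⟨hva, h⟩)
          simp [hg', hvS, hS v hvS])
    have h2 := mul_le_mul_of_nonneg_left (hφ S hne) (hg a)
    have h3 := G.sum_abs_sub_indicator hT
    have h4 : ∑ v ∈ T, g v = ∑ v ∈ T, g' v + g a * #S := by
      have : (#S : ℝ) = ∑ v ∈ T, if v ∈ S then (1 : ℝ) else 0 := by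
        rw [← sum_filter, filter_mem_eq_inter,
          inter_eq_right.2 ((G.subset_closedNbhd S).trans hT)]
        simp
      rw [this, mul_sum, ← sum_add_distrib]
      exact sum_congr rfl fun v _ => by simp [hg']
    have h5 : ∑ v ∈ T, ∑ w ∈ G.neighborFinset v, |g v - g w| =
        ∑ v ∈ T, ∑ w ∈ G.neighborFinset v, |g' v - g' w| + g a * (2 * G.cutSize S) := by
      rw [← h3, mul_sum, ← sum_add_distrib]
      refine sum_congr rfl fun v _ => ?_
      rw [mul_sum, ← sum_add_distrib]
      refine sum_congr rfl fun w _ => ?_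
      by_cases hv : v ∈ S <;> by_cases hw : w ∈ S
      · simp [hg', hv, hw]
      · have := hmin v hv
        have := hg a
        simp only [hg', hv, hw, hS w hw, if_true, if_false, mul_one, mul_zero, sub_zero, abs_one]
        rw [abs_of_nonneg (hg v), abs_of_nonneg (by linarith)]
        ring
      · have := hmin w hw
        have := hg a
        simp only [hg', hv, hw, hS v hv, if_true, if_false, mul_one, mul_zero, sub_zero, zero_sub,
          abs_neg, abs_one]
        rw [abs_of_nonneg (hg w), abs_of_nonneg (by linarith)]
        ring
      · simp [hg', hv, hw]
    rw [h4, h5]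
    linarith

theorem cheeger_of_finite_support {Δ : ℕ} (hreg : G.IsRegularOfDegree Δ) (hΔ : Δ ≠ 0) {φ : ℝ}
    (hφ0 : 0 ≤ φ) (hφ : ∀ W : Finset V, W.Nonempty → φ * (Δ * #W) ≤ G.cutSize W)
    {S : Finset V} {f : V → ℝ} (hS : ∀ v ∉ S, f v = 0) :
    φ ^ 2 / 2 * ∑' v, f v * f v ≤ ∑' v, f v * (f v - G.srwOperator f v) := by
  set T := G.closedNbhd S
  have hTf : ∀ v ∉ T, f v = 0 := fun v hv => hS v fun h => hv (G.subset_closedNbhd S h)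
  have h1 := G.coarea_le hφ T S subset_rfl (fun v => f v * f v) (fun v => mul_self_nonneg _)
    (fun v hv => by simp [hS v hv])
  have h2 := G.sum_sq_sub_eq hreg hΔ (T := T) subset_rfl hS
  have h3 := G.sum_sq_add_le hreg (T := T) subset_rfl hS
  -- The weighted bound `φ|ab| ≤ a² + φ²b²/4` replaces Cauchy–Schwarz. Its last term absorbs half of
  -- the left side of the co-area inequality for `f²`.
  have h4 : φ * ∑ v ∈ T, ∑ w ∈ G.neighborFinset v, |f v * f v - f w * f w| ≤
      ∑ v ∈ T, ∑ w ∈ G.neighborFinset v, (f v - f w) ^ 2 +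
        φ ^ 2 / 4 * ∑ v ∈ T, ∑ w ∈ G.neighborFinset v, (f v + f w) ^ 2 := by
    rw [mul_sum, mul_sum, ← sum_add_distrib]
    refine sum_le_sum fun v _ => ?_
    rw [mul_sum, mul_sum, ← sum_add_distrib]
    refine sum_le_sum fun w _ => ?_
    have h5 : f v * f v - f w * f w = (f v - f w) * (f v + f w) := by ring
    rw [h5, abs_mul, ← sq_abs (f v - f w), ← sq_abs (f v + f w)]
    nlinarith [sq_nonneg (|f v - f w| - φ / 2 * |f v + f w|)]
  rw [tsum_eq_sum (s := T) fun v hv => by rw [hTf v hv, zero_mul]]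
  rw [h2] at h4
  have h6 := mul_le_mul_of_nonneg_left h1 hφ0
  have h7 := mul_le_mul_of_nonneg_left h3 (by positivity : 0 ≤ φ ^ 2 / 4)
  have hpos : (0 : ℝ) < 2 * Δ := by positivity
  refine le_of_mul_le_mul_left ?_ hpos
  linarith

/-- It suffices to test spectral lower bounds against functions of finite support. -/
theorem mem_spectralLowerBounds_of_finite_support {Δ : ℕ} (hreg : G.IsRegularOfDegree Δ) {l : ℝ}
    (h : ∀ (S : Finset V) (f : V → ℝ), (∀ v ∉ S, f v = 0) →
      l * ∑' v, f v * f v ≤ ∑' v, f v * (f v - G.srwOperator f v)) :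
    l ∈ G.spectralLowerBounds := by
  intro f hf
  have hsum : Summable fun v => f v ^ 2 := by
    have := (memℓp_gen_iff (by simp)).1 hf
    simpa using this
  -- Each `f w ^ 2` occurs for exactly `Δ` vertices `v`, which bounds the partial sums; this feeds
  -- the dominating function for the truncations of `f`.
  have hN : Summable fun v => ∑ w ∈ G.neighborFinset v, f w ^ 2 := by
    refine summable_of_sum_le (c := Δ * ∑' v, f v ^ 2)
      (fun v => sum_nonneg fun w _ => sq_nonneg _) fun F => ?_
    set T := G.closedNbhd F
    calc ∑ v ∈ F, ∑ w ∈ G.neighborFinset v, f w ^ 2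
        = ∑ v ∈ F, ∑ w ∈ G.neighborFinset v, if w ∈ T then f w ^ 2 else 0 := by
          refine sum_congr rfl fun v hv => sum_congr rfl fun w hw => ?_
          rw [if_pos (mem_closedNbhd_of_adj hv (by simpa using hw))]
      _ ≤ ∑ v ∈ G.closedNbhd T, ∑ w ∈ G.neighborFinset v, if w ∈ T then f w ^ 2 else 0 := by
          refine sum_le_sum_of_subset_of_nonneg
            ((G.subset_closedNbhd F).trans (G.subset_closedNbhd T)) fun v _ _ => ?_
          exact sum_nonneg fun w _ => by split_ifs <;> positivity
      _ = Δ * ∑ v ∈ G.closedNbhd T, if v ∈ T then f v ^ 2 else 0 :=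
          G.sum_sum_neighborFinset hreg (S := T) subset_rfl
            (h := fun w => if w ∈ T then f w ^ 2 else 0) fun v hv => if_neg hv
      _ ≤ Δ * ∑' v, f v ^ 2 := by
          refine mul_le_mul_of_nonneg_left ?_ (Nat.cast_nonneg _)
          refine le_trans (sum_le_sum fun v _ => ?_)
            (hsum.sum_le_tsum (G.closedNbhd T) fun v _ => sq_nonneg _)
          split_ifs <;> [exact le_rfl; positivity]
  set fF : Finset V → V → ℝ := fun F v => if v ∈ F then f v else 0 with hfF
  have hlim : ∀ v, ∀ᶠ F in atTop, fF F v = f v := by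
    intro v
    filter_upwards [eventually_ge_atTop {v}] with F hF
    exact if_pos (hF (mem_singleton_self v))
  have habs : ∀ F v, |fF F v| ≤ |f v| := by
    intro F v
    simp only [hfF]
    split_ifs <;> simp
  have hleft : Tendsto (fun F => ∑' v, fF F v * fF F v) atTop (𝓝 (∑' v, f v * f v)) := by
    refine tendsto_tsum_of_dominated_convergence hsum
      (fun v => tendsto_nhds_of_eventually_eq ?_) (Eventually.of_forall fun F v => ?_)
    · filter_upwards [hlim v] with F hF
      rw [hF]
    · rw [Real.norm_eq_abs, abs_mul, ← sq, ← sq_abs (f v)]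
      exact pow_le_pow_left₀ (abs_nonneg _) (habs F v) 2
  have hright : Tendsto (fun F => ∑' v, fF F v * (fF F v - G.srwOperator (fF F) v)) atTop
      (𝓝 (∑' v, f v * (f v - G.srwOperator f v))) := by
    refine tendsto_tsum_of_dominated_convergence
      (bound := fun v => f v ^ 2 + ∑ w ∈ G.neighborFinset v, 1 / (Δ : ℝ) * (f v ^ 2 + f w ^ 2))
      ?_ (fun v => tendsto_nhds_of_eventually_eq ?_) (Eventually.of_forall fun F v => ?_)
    · refine hsum.add ?_
      simp_rw [← mul_sum, sum_add_distrib, sum_const, card_neighborFinset_eq_degree, hreg.degree_eq,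
        nsmul_eq_mul]
      exact ((hsum.mul_left _).add hN).mul_left _
    · have : ∀ᶠ F in atTop, ∀ w ∈ G.neighborFinset v, fF F w = f w :=
        (eventually_all_finset _).2 fun w _ => hlim w
      filter_upwards [hlim v, this] with F hF hF'
      rw [hF, srwOperator, srwOperator, sum_congr rfl fun w hw => by rw [hF' w hw]]
    · rw [mul_sub, srwOperator, mul_sum, hreg v, Real.norm_eq_abs]
      refine (abs_sub _ _).trans (add_le_add ?_ ((abs_sum_le_sum_abs _ _).trans
        (sum_le_sum fun w _ => ?_)))
      · rw [abs_mul, ← sq, ← sq_abs (f v)]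
        exact pow_le_pow_left₀ (abs_nonneg _) (habs F v) 2
      · rw [mul_left_comm, abs_mul, abs_of_nonneg (by positivity : 0 ≤ 1 / (Δ : ℝ)), abs_mul]
        refine mul_le_mul_of_nonneg_left ?_ (by positivity)
        rw [← sq_abs (f v), ← sq_abs (f w)]
        have := mul_le_mul (habs F v) (habs F w) (abs_nonneg _) (abs_nonneg _)
        nlinarith [sq_nonneg (|f v| - |f w|), sq_nonneg (|f v|), sq_nonneg (|f w|)]
  exact le_of_tendsto_of_tendsto' (hleft.const_mul l) hright fun F =>
    h F (fF F) fun v hv => if_neg hv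

theorem memℓp_of_finite_support {S : Finset V} {f : V → ℝ} (hS : ∀ v ∉ S, f v = 0) :
    Memℓp f 2 := by
  refine (memℓp_zero ?_).of_exponent_ge zero_le
  exact S.finite_toSet.subset fun v hv => by
    by_contra h
    exact hv (hS v h)

theorem sq_div_two_mem_spectralLowerBounds {Δ : ℕ} (hreg : G.IsRegularOfDegree Δ) (hΔ : Δ ≠ 0)
    {φ : ℝ} (hφ0 : 0 ≤ φ)
    (hφ : ∀ W : Finset V, W.Nonempty → φ * (Δ * #W) ≤ G.cutSize W) :
    φ ^ 2 / 2 ∈ G.spectralLowerBounds :=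
  G.mem_spectralLowerBounds_of_finite_support hreg fun _ _ hS =>
    G.cheeger_of_finite_support hreg hΔ hφ0 hφ hS

theorem bddAbove_spectralLowerBounds [Nonempty V] : BddAbove G.spectralLowerBounds := by
  obtain ⟨o⟩ := ‹Nonempty V›
  set f : V → ℝ := fun v => if v = o then 1 else 0 with hf
  refine ⟨∑' v, f v * (f v - G.srwOperator f v), fun l hl => ?_⟩
  have h1 := hl f (memℓp_of_finite_support (S := {o}) fun v hv => if_neg (by simpa using hv))
  have h2 : ∑' v, f v * f v = 1 := by
    rw [tsum_eq_single o fun v hv => by simp [hf, hv]]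
    simp [hf]
  rwa [h2, mul_one] at h1

theorem isGreatest_spectralBottom [Nonempty V] (hne : G.spectralLowerBounds.Nonempty) :
    IsGreatest G.spectralLowerBounds G.spectralBottom := by
  refine ⟨fun f hf => ?_, fun l hl => le_csSup G.bddAbove_spectralLowerBounds hl⟩
  have h0 : 0 ≤ ∑' v, f v * f v := tsum_nonneg fun v => mul_self_nonneg _
  rcases h0.eq_or_lt with h0 | h0
  -- For `f` of zero norm the inequality does not depend on the constant, so any member of the set
  -- settles it.
  · obtain ⟨l, hl⟩ := hne
    have := hl f hf
    rwa [← h0, mul_zero] at this ⊢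
  · rw [← le_div_iff₀ h0]
    exact csSup_le hne fun l hl => (le_div_iff₀ h0).2 (hl f hf)

/-- Edges leaving the neighbourhood start at its new vertices. Each of these spends at least one
edge on `S`, and there are at most `|∂S|` of them. -/
theorem cutSize_closedNbhd_le {Δ : ℕ} (hreg : G.IsRegularOfDegree Δ) (S : Finset V) :
    G.cutSize (G.closedNbhd S) ≤ (Δ - 1) * G.cutSize S := by
  have h1 : G.cutSize (G.closedNbhd S) =
      ∑ u ∈ G.closedNbhd S \ S, #(G.neighborFinset u \ G.closedNbhd S) := by
    refine (sum_subset sdiff_subset fun u hu hu' => ?_).symm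
    have huS : u ∈ S := by
      by_contra h
      exact hu' (mem_sdiff.2 ⟨hu, h⟩)
    rw [card_eq_zero, sdiff_eq_empty_iff_subset]
    exact fun v hv => mem_closedNbhd_of_adj huS (by simpa using hv)
  have h2 : ∀ u ∈ G.closedNbhd S \ S, #(G.neighborFinset u \ G.closedNbhd S) ≤ Δ - 1 := by
    intro u hu
    obtain ⟨hu, huS⟩ := mem_sdiff.1 hu
    obtain ⟨v, hv, huv⟩ := mem_biUnion.1 ((mem_union.1 hu).resolve_left huS)
    rw [mem_neighborFinset] at huv
    have hv' : v ∈ G.neighborFinset u := by simpa using huv.symm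
    rw [← hreg u, ← card_neighborFinset_eq_degree, ← card_erase_of_mem hv']
    refine card_le_card fun w hw => ?_
    obtain ⟨hw, hwS⟩ := mem_sdiff.1 hw
    exact mem_erase.2 ⟨fun h => hwS (h ▸ G.subset_closedNbhd S hv), hw⟩
  have h3 : #(G.closedNbhd S \ S) ≤ G.cutSize S := by
    refine le_trans (card_le_card fun u hu => ?_) (card_biUnion_le (s := S)
      (t := fun u => G.neighborFinset u \ S))
    obtain ⟨hu, huS⟩ := mem_sdiff.1 hu
    obtain ⟨v, hv, huv⟩ := mem_biUnion.1 ((mem_union.1 hu).resolve_left huS)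
    exact mem_biUnion.2 ⟨v, hv, mem_sdiff.2 ⟨huv, huS⟩⟩
  rw [h1]
  refine (sum_le_card_nsmul _ _ _ h2).trans ?_
  rw [smul_eq_mul, mul_comm]
  exact Nat.mul_le_mul_left _ h3

/-- The function decaying geometrically with ratio `β` on the balls around `W`, cut off at
radius `K`. -/
def geometricProfile (W : Finset V) (β : ℝ) (K : ℕ) (v : V) : ℝ :=
  ∑ k ∈ range K, β ^ k * if v ∈ G.closedNbhd^[k] W then 1 else 0

theorem mem_of_geometricProfile_ne_zero {W : Finset V} {β : ℝ} {K : ℕ} {v : V}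
    (h : G.geometricProfile W β K v ≠ 0) :
    v ∈ G.closedNbhd^[K] W ∧ ∀ w, G.Adj v w → w ∈ G.closedNbhd^[K] W := by
  induction K with
  | zero => simp [geometricProfile] at h
  | succ K ih =>
    have hv : v ∈ G.closedNbhd^[K] W := by
      by_contra hv
      rw [geometricProfile, sum_range_succ, if_neg hv, mul_zero, add_zero] at h
      exact hv (ih h).1
    rw [Function.iterate_succ_apply']
    exact ⟨G.subset_closedNbhd _ hv, fun w hw => mem_closedNbhd_of_adj hv hw⟩

/-- An edge leaving one ball around `W` lies inside all larger balls and outside all smaller ones.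
So the profile changes by a single power of `β` along it, and no cross terms arise. -/
theorem sum_sq_sub_geometricProfile (W : Finset V) (β : ℝ) (K : ℕ) {T : Finset V}
    (hT : ∀ k ≤ K, G.closedNbhd^[k] W ⊆ T) :
    ∑ v ∈ T, ∑ w ∈ G.neighborFinset v,
      (G.geometricProfile W β K v - G.geometricProfile W β K w) ^ 2 =
      2 * ∑ k ∈ range K, (β ^ k) ^ 2 * G.cutSize (G.closedNbhd^[k] W) := by
  induction K with
  | zero => simp [geometricProfile]
  | succ K ih =>
    have hK : G.closedNbhd (G.closedNbhd^[K] W) ⊆ T := by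
      rw [← Function.iterate_succ_apply' (f := G.closedNbhd)]
      exact hT _ le_rfl
    rw [sum_range_succ, mul_add, ← ih fun k hk => hT k (hk.trans K.le_succ), mul_left_comm,
      ← G.sum_abs_sub_indicator hK, mul_sum, ← sum_add_distrib]
    refine sum_congr rfl fun v _ => ?_
    rw [mul_sum, ← sum_add_distrib]
    refine sum_congr rfl fun w hw => ?_
    rw [mem_neighborFinset] at hw
    have hs : ∀ u, G.geometricProfile W β (K + 1) u = G.geometricProfile W β K u +
        β ^ K * if u ∈ G.closedNbhd^[K] W then 1 else 0 := fun u => sum_range_succ _ _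
    rw [hs, hs]
    by_cases hvS : v ∈ G.closedNbhd^[K] W <;> by_cases hwS : w ∈ G.closedNbhd^[K] W
    · simp [hvS, hwS]
    · have h1 : G.geometricProfile W β K v = 0 := by
        by_contra h
        exact hwS ((G.mem_of_geometricProfile_ne_zero h).2 w hw)
      have h2 : G.geometricProfile W β K w = 0 := by
        by_contra h
        exact hwS (G.mem_of_geometricProfile_ne_zero h).1
      simp [hvS, hwS, h1, h2]
    · have h1 : G.geometricProfile W β K w = 0 := by
        by_contra h
        exact hvS ((G.mem_of_geometricProfile_ne_zero h).2 v hw.symm)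
      have h2 : G.geometricProfile W β K v = 0 := by
        by_contra h
        exact hvS (G.mem_of_geometricProfile_ne_zero h).1
      simp [hvS, hwS, h1, h2]
    · simp [hvS, hwS]

theorem subset_iterate_closedNbhd (W : Finset V) {j k : ℕ} (h : j ≤ k) :
    G.closedNbhd^[j] W ⊆ G.closedNbhd^[k] W := by
  induction k, h using Nat.le_induction with
  | base => exact subset_rfl
  | succ k _ ih =>
    rw [Function.iterate_succ_apply']
    exact ih.trans (G.subset_closedNbhd _)

theorem cutSize_iterate_closedNbhd_le {Δ : ℕ} (hreg : G.IsRegularOfDegree Δ) (W : Finset V)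
    (k : ℕ) : G.cutSize (G.closedNbhd^[k] W) ≤ (Δ - 1) ^ k * G.cutSize W := by
  induction k with
  | zero => simp
  | succ k ih =>
    rw [Function.iterate_succ_apply', pow_succ', mul_assoc]
    exact (G.cutSize_closedNbhd_le hreg _).trans (Nat.mul_le_mul_left _ ih)

/-- An isoperimetric inequality with the constant improved by the geometric tails of the test
functions. -/
theorem mul_card_le_cutSize {Δ : ℕ} (hreg : G.IsRegularOfDegree Δ) (hΔ : 3 ≤ Δ) {l : ℝ}
    (hl : l ∈ G.spectralLowerBounds) (hl0 : 0 ≤ l) (W : Finset V) :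
    l * (Δ * (Δ - 1) / (Δ - 2)) * #W ≤ G.cutSize W := by
  have hΔ3 : (3 : ℝ) ≤ Δ := by exact_mod_cast hΔ
  -- Cuts of balls grow at most by the factor `Δ - 1`. With this ratio the energy `∑ β^(2k) (Δ-1)^k
  -- |∂W|` collapses to `|∂W| ∑ β^k`, while the squared norm is at least `|W| (∑ β^k)²`.
  set β : ℝ := ((Δ : ℝ) - 1)⁻¹ with hβ
  have hβ0 : 0 < β := inv_pos.2 (by linarith)
  have hβ1 : β < 1 := inv_lt_one_of_one_lt₀ (by linarith)
  set s : ℕ → ℝ := fun K => ∑ k ∈ range K, β ^ k with hs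
  have hlim : Tendsto (fun K => l * Δ * #W * s (K + 1)) atTop
      (𝓝 (l * Δ * #W * (1 - β)⁻¹)) :=
    (((hasSum_geometric_of_lt_one hβ0.le hβ1).tendsto_sum_nat).comp
      (tendsto_add_atTop_nat 1)).const_mul _
  have heq : l * (Δ * (Δ - 1) / (Δ - 2)) * #W = l * Δ * #W * (1 - β)⁻¹ := by
    have h1 : (Δ : ℝ) - 1 ≠ 0 := by linarith
    have h2 : (Δ : ℝ) - 2 ≠ 0 := by linarith
    have h3 : 1 - β = (Δ - 2) / (Δ - 1) := by
      rw [hβ]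
      field_simp
      ring
    rw [h3, inv_div]
    ring
  rw [heq]
  refine le_of_tendsto' hlim fun n => ?_
  -- The shift makes `s K` positive, so one factor can be cancelled.
  set K := n + 1
  have hsK : 0 < s K := sum_pos (fun k _ => by positivity) (by simp [K])
  set f := G.geometricProfile W β K
  set T := G.closedNbhd^[K + 1] W
  have hS : ∀ v ∉ G.closedNbhd^[K] W, f v = 0 := fun v hv => by
    by_contra h
    exact hv (G.mem_of_geometricProfile_ne_zero h).1
  have hT : G.closedNbhd (G.closedNbhd^[K] W) ⊆ T :=
    (Function.iterate_succ_apply' G.closedNbhd K W).symm.subset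
  have hTf : ∀ v ∉ T, f v = 0 := fun v hv => hS v fun h => hv (hT (G.subset_closedNbhd _ h))
  have h1 := hl f (memℓp_of_finite_support hS)
  have h2 := G.sum_sq_sub_eq hreg (by omega) hT hS
  rw [G.sum_sq_sub_geometricProfile W β K fun k hk =>
    G.subset_iterate_closedNbhd W (by omega)] at h2
  have h3 : ∑ k ∈ range K, (β ^ k) ^ 2 * G.cutSize (G.closedNbhd^[k] W) ≤ G.cutSize W * s K := by
    rw [hs, mul_sum]
    refine sum_le_sum fun k _ => ?_
    have h4 : (G.cutSize (G.closedNbhd^[k] W) : ℝ) ≤ ((Δ : ℝ) - 1) ^ k * G.cutSize W := by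
      have := G.cutSize_iterate_closedNbhd_le hreg W k
      have h5 : ((Δ - 1 : ℕ) : ℝ) = (Δ : ℝ) - 1 := by
        rw [Nat.cast_sub (by omega), Nat.cast_one]
      rw [← h5]
      exact_mod_cast this
    refine (mul_le_mul_of_nonneg_left h4 (by positivity)).trans (le_of_eq ?_)
    have h6 : β ^ k * ((Δ : ℝ) - 1) ^ k = 1 := by
      rw [← mul_pow, hβ, inv_mul_cancel₀ (by linarith), one_pow]
    linear_combination β ^ k * G.cutSize W * h6
  have h4 : #W * s K ^ 2 ≤ ∑' v, f v * f v := by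
    rw [tsum_eq_sum (s := T) fun v hv => by rw [hTf v hv, zero_mul]]
    calc #W * s K ^ 2 = ∑ v ∈ W, f v * f v := by
          rw [← nsmul_eq_mul, ← sum_const]
          refine sum_congr rfl fun v hv => ?_
          have : f v = s K := sum_congr rfl fun k _ => by
            rw [if_pos (G.subset_iterate_closedNbhd W (Nat.zero_le k) hv), mul_one]
          rw [this, sq]
      _ ≤ ∑ v ∈ T, f v * f v :=
          sum_le_sum_of_subset_of_nonneg (G.subset_iterate_closedNbhd W (Nat.zero_le (K + 1)))
            fun v _ _ => mul_self_nonneg _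
  have h5 := mul_le_mul_of_nonneg_left h4 hl0
  have h6 : (Δ : ℝ) * (l * (#W * s K ^ 2)) ≤ Δ * ∑' v, f v * (f v - G.srwOperator f v) :=
    mul_le_mul_of_nonneg_left (h5.trans h1) (by positivity)
  refine le_of_mul_le_mul_right ?_ hsK
  linarith

end SimpleGraph

end

noncomputable section

namespace SimpleGraph

open Finset Filter Topology

/-! ### Finiteness, invariance and submultiplicativity of the walk counts -/

section Counting

variable {V : Type*} (G : SimpleGraph V)

theorem finite_setOf_walk_length_eq [G.LocallyFinite] (n : ℕ) :
    ∀ u : V, {p : Σ v : V, G.Walk u v | p.2.length = n}.Finite := by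
  induction n with
  | zero =>
    intro u
    refine (Set.finite_singleton (⟨u, Walk.nil⟩ : Σ v : V, G.Walk u v)).subset ?_
    rintro ⟨v, p⟩ hp
    cases p with
    | nil => rfl
    | cons h p => simp at hp
  | succ n ih =>
    intro u
    refine (Set.finite_iUnion fun w : G.neighborSet u =>
      (ih w).image fun q => (⟨q.1, Walk.cons w.2 q.2⟩ : Σ v : V, G.Walk u v)).subset ?_
    rintro ⟨v, p⟩ hp
    cases p with
    | nil => simp at hp
    | @cons _ w _ h p =>
      refine Set.mem_iUnion.2 ⟨⟨w, h⟩, ⟨v, p⟩, ?_, rfl⟩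
      simpa using hp

theorem finite_selfAvoidingWalks [G.LocallyFinite] (u : V) (n : ℕ) :
    (G.selfAvoidingWalks u n).Finite :=
  (G.finite_setOf_walk_length_eq n u).subset fun _ hp => hp.2

theorem sawCount_apply_le [G.LocallyFinite] (α : G ≃g G) (u : V) (n : ℕ) :
    G.sawCount u n ≤ G.sawCount (α u) n := by
  refine Set.ncard_le_ncard_of_injOn
    (fun p => (⟨α p.1, p.2.map α.toHom⟩ : Σ v : V, G.Walk (α u) v)) ?_ ?_
    (G.finite_selfAvoidingWalks _ n)
  · rintro ⟨v, p⟩ ⟨hp, hn⟩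
    exact ⟨hp.map α.injective, (Walk.length_map _ _).trans hn⟩
  · rintro ⟨v, p⟩ _ ⟨w, q⟩ _ h
    rw [Sigma.mk.injEq] at h
    obtain ⟨h1, h2⟩ := h
    obtain rfl := α.injective h1
    exact congrArg _ (Walk.map_injective_of_injective α.injective _ _ (eq_of_heq h2))

theorem sawCount_eq [G.LocallyFinite] (htrans : G.IsVertexTransitive) (u v : V) (n : ℕ) :
    G.sawCount u n = G.sawCount v n := by
  obtain ⟨α, rfl⟩ := htrans u v
  refine le_antisymm (G.sawCount_apply_le α u n) ?_
  simpa using G.sawCount_apply_le α.symm (α u) n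

/-- Cut a walk after `m` steps: both pieces are self-avoiding, and by transitivity the number of
second pieces does not depend on where they start. -/
theorem sawCount_add_le [G.LocallyFinite] (htrans : G.IsVertexTransitive) (o : V) (m n : ℕ) :
    G.sawCount o (m + n) ≤ G.sawCount o m * G.sawCount o n := by
  classical
  have hfin := G.finite_selfAvoidingWalks o m
  have hsub : G.selfAvoidingWalks o (m + n) ⊆ ⋃ q ∈ hfin.toFinset,
      (fun r => (⟨r.1, q.2.append r.2⟩ : Σ v : V, G.Walk o v)) '' G.selfAvoidingWalks q.1 n := by
    rintro ⟨v, p⟩ ⟨hp, hlen⟩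
    refine Set.mem_biUnion (x := (⟨_, p.take m⟩ : Σ v : V, G.Walk o v)) ?_
      ⟨⟨v, p.drop m⟩, ⟨hp.drop m, ?_⟩, ?_⟩
    · refine hfin.mem_toFinset.2 ⟨hp.take m, ?_⟩
      simp only at hlen ⊢
      rw [Walk.take_length, hlen]
      omega
    · simp only at hlen ⊢
      rw [Walk.drop_length, hlen]
      omega
    · simp [Walk.append_take_drop_eq]
  calc G.sawCount o (m + n)
      ≤ _ := Set.ncard_le_ncard hsub (Set.Finite.biUnion hfin.toFinset.finite_toSet fun q _ =>
        (G.finite_selfAvoidingWalks q.1 n).image _)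
    _ ≤ ∑ q ∈ hfin.toFinset, ((fun r => (⟨r.1, q.2.append r.2⟩ : Σ v : V, G.Walk o v)) ''
        G.selfAvoidingWalks q.1 n).ncard := Finset.set_ncard_biUnion_le _ _
    _ ≤ ∑ _q ∈ hfin.toFinset, G.sawCount o n := by
        refine sum_le_sum fun q _ => ?_
        rw [← G.sawCount_eq htrans q.1 o n]
        exact Set.ncard_image_le (G.finite_selfAvoidingWalks q.1 n)
    _ = G.sawCount o m * G.sawCount o n := by
        rw [sum_const, smul_eq_mul, ← Set.ncard_eq_toFinset_card _ hfin, sawCount, sawCount]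

end Counting

/-! ### Walks that avoid enclosed regions, and their branching -/

section Extendable

variable {V : Type*} [DecidableEq V] [Infinite V] {G : SimpleGraph V} [G.LocallyFinite]
  (hconn : G.Connected)

/-- A saturated filling of `W` with the new vertex `x`. -/
def filling (W : Finset V) (x : V) : Finset V :=
  (G.exists_isFilling_saturated hconn W x).choose

/-- The vertices of a list, together with the finite components that are cut off when the vertices
of the list are removed one after the other, from the last to the first. -/
def fillList : List V → Finset V
  | [] => ∅
  | x :: l => filling hconn (fillList l) x

theorem isFilling_fillList (x : V) (l : List V) :
    G.IsFilling (fillList hconn l) x (fillList hconn (x :: l)) :=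
  (G.exists_isFilling_saturated hconn (fillList hconn l) x).choose_spec.1

theorem saturated_fillList : ∀ l : List V, G.Saturated (fillList hconn l)
  | [] => G.saturated_empty hconn
  | x :: l => (G.exists_isFilling_saturated hconn (fillList hconn l) x).choose_spec.2

theorem mem_fillList {l : List V} {a : V} (ha : a ∈ l) : a ∈ fillList hconn l := by
  induction l with
  | nil => simp at ha
  | cons x l ih =>
    rcases List.mem_cons.1 ha with rfl | ha
    · exact (isFilling_fillList hconn a l).mem
    · exact (isFilling_fillList hconn x l).subset (ih ha)

/-- The possible next steps after a walk whose vertices are listed in reverse order. -/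
def extensions : List V → Finset V
  | [] => ∅
  | x :: l => G.neighborFinset x \ fillList hconn (x :: l)

/-- Self-avoiding walks from `o`, with the vertices listed in reverse order, none of whose steps
enters a region that has been cut off from infinity. -/
inductive IsExtendable (o : V) : List V → Prop
  | single : IsExtendable o [o]
  | cons {x : V} {l : List V} (h : IsExtendable o l) (hx : x ∈ extensions hconn l) :
      IsExtendable o (x :: l)

/-- The extendable walks of a given length. -/
def extendableLists (o : V) : ℕ → Finset (List V)
  | 0 => {[o]}
  | n + 1 => (extendableLists o n).biUnion fun l => (extensions hconn l).image (· :: l)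

/-- The product of the numbers of extensions along a walk. -/
def branching : List V → ℕ
  | [] => 1
  | x :: l => #(extensions hconn (x :: l)) * branching l

/-- The sum of the numbers of extensions along a walk. -/
def extensionSum : List V → ℕ
  | [] => 0
  | x :: l => #(extensions hconn (x :: l)) + extensionSum l

variable {hconn} {o : V}

theorem isExtendable_of_mem {n : ℕ} {l : List V} (h : l ∈ extendableLists hconn o n) :
    IsExtendable hconn o l ∧ l.length = n + 1 := by
  induction n generalizing l with
  | zero =>
    obtain rfl := mem_singleton.1 h
    exact ⟨.single, rfl⟩
  | succ n ih =>
    obtain ⟨l', hl', h⟩ := mem_biUnion.1 h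
    obtain ⟨x, hx, rfl⟩ := mem_image.1 h
    exact ⟨.cons (ih hl').1 hx, by rw [List.length_cons, (ih hl').2]⟩

theorem IsExtendable.notMem_fillList {x : V} {l : List V} (h : IsExtendable hconn o (x :: l)) :
    x ∉ fillList hconn l := by
  cases h with
  | single => simp [fillList]
  | cons h hx =>
    cases h with
    | single => exact (mem_sdiff.1 hx).2
    | cons h' hx' => exact (mem_sdiff.1 hx).2

theorem IsExtendable.tail {x y : V} {l : List V} (h : IsExtendable hconn o (x :: y :: l)) :
    IsExtendable hconn o (y :: l) ∧ G.Adj y x := by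
  cases h with
  | cons h hx => exact ⟨h, by simpa using (mem_sdiff.1 hx).1⟩

theorem IsExtendable.extensions_nonempty {l : List V} (h : IsExtendable hconn o l) :
    (extensions hconn l).Nonempty := by
  cases l with
  | nil => cases h
  | cons x l =>
    exact (isFilling_fillList hconn x l).nonempty h.notMem_fillList (saturated_fillList hconn l)

theorem IsExtendable.length_le_card {l : List V} (h : IsExtendable hconn o l) :
    l.length ≤ #(fillList hconn l) := by
  have key : ∀ {x : V} {l : List V}, IsExtendable hconn o (x :: l) →
      #(fillList hconn l) < #(fillList hconn (x :: l)) := fun {x l} h =>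
    card_lt_card ⟨(isFilling_fillList hconn x l).subset, fun hs =>
      h.notMem_fillList (hs (isFilling_fillList hconn x l).mem)⟩
  induction h with
  | single => exact Nat.succ_le_of_lt ((Nat.zero_le _).trans_lt (key .single))
  | cons h hx ih => exact Nat.succ_le_of_lt (ih.trans_lt (key (.cons h hx)))

/-- The one-step estimate for fillings telescopes along the walk, starting from the empty cut. -/
theorem IsExtendable.cutSize_add_le {l : List V} (htrans : G.IsVertexTransitive) {Δ : ℕ}
    (hreg : G.IsRegularOfDegree Δ) (h : IsExtendable hconn o l) :
    G.cutSize (fillList hconn l) + Δ * l.length ≤ 2 * extensionSum hconn l := by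
  have key : ∀ {x : V} {l : List V}, IsExtendable hconn o (x :: l) →
      G.cutSize (fillList hconn (x :: l)) + Δ ≤
        G.cutSize (fillList hconn l) + 2 * #(extensions hconn (x :: l)) := fun {x l} h =>
    (isFilling_fillList hconn x l).cutSize_add_le hconn htrans hreg h.notMem_fillList
  induction h with
  | single =>
    have := key (.single (o := o))
    simpa [fillList, cutSize, extensionSum] using this
  | @cons x l h hx ih =>
    have := key (.cons h hx)
    rw [extensionSum, List.length_cons, mul_add]
    omega

/-- The preceding vertex is a neighbour that has already been filled. -/
theorem IsExtendable.card_extensions_lt {Δ : ℕ} (hreg : G.IsRegularOfDegree Δ) {x y : V}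
    {l : List V} (h : IsExtendable hconn o (x :: y :: l)) :
    #(extensions hconn (x :: y :: l)) < Δ := by
  rw [← hreg x, ← card_neighborFinset_eq_degree]
  refine card_lt_card ⟨sdiff_subset, fun hs => ?_⟩
  have hy : y ∈ G.neighborFinset x := by simpa using h.tail.2.symm
  exact (mem_sdiff.1 (hs hy)).2 (mem_fillList hconn (by simp))

/-- Bernoulli's inequality for exponents in `[0, 1]`, equivalently concavity of the logarithm, with
equality at `d = 1` and `d = Δ - 1`. -/
theorem rpow_le_natCast {Δ d : ℕ} (hΔ : 3 ≤ Δ) (hd : 1 ≤ d) (hdΔ : d < Δ) :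
    ((Δ : ℝ) - 1) ^ (((d : ℝ) - 1) / (Δ - 2)) ≤ d := by
  have hΔ3 : (3 : ℝ) ≤ Δ := by exact_mod_cast hΔ
  have hd1 : (1 : ℝ) ≤ d := by exact_mod_cast hd
  have hd2 : (d : ℝ) + 1 ≤ Δ := by exact_mod_cast hdΔ
  have hpos : (0 : ℝ) < Δ - 2 := by linarith
  have h := rpow_one_add_le_one_add_mul_self (s := (Δ : ℝ) - 2) (by linarith)
    (p := ((d : ℝ) - 1) / (Δ - 2)) (div_nonneg (by linarith) hpos.le)
    ((div_le_one hpos).2 (by linarith))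
  rw [div_mul_cancel₀ _ hpos.ne'] at h
  have h1 : 1 + ((Δ : ℝ) - 2) = Δ - 1 := by ring
  have h2 : 1 + ((d : ℝ) - 1) = d := by ring
  rwa [h1, h2] at h

theorem IsExtendable.rpow_le_branching {Δ : ℕ} (hreg : G.IsRegularOfDegree Δ) (hΔ : 3 ≤ Δ)
    {l : List V} (h : IsExtendable hconn o l) :
    ((Δ : ℝ) - 1) ^ (((extensionSum hconn l : ℝ) - l.length) / (Δ - 2)) ≤
      ((Δ : ℝ) - 1) ^ 2 * branching hconn l := by
  have hΔ3 : (3 : ℝ) ≤ Δ := by exact_mod_cast hΔ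
  have hpos : (0 : ℝ) < Δ - 2 := by linarith
  induction h with
  | single =>
    have hle : #(extensions hconn [o]) ≤ Δ := by
      rw [← hreg o, ← card_neighborFinset_eq_degree]
      exact card_le_card sdiff_subset
    have hle' : (#(extensions hconn [o]) : ℝ) ≤ Δ := by exact_mod_cast hle
    have h1 : (1 : ℝ) ≤ #(extensions hconn [o]) := by
      exact_mod_cast card_pos.2 (IsExtendable.extensions_nonempty (.single (hconn := hconn)))
    simp only [extensionSum, branching, List.length_singleton, add_zero, mul_one, Nat.cast_one]
    calc ((Δ : ℝ) - 1) ^ (((#(extensions hconn [o]) : ℝ) - 1) / (Δ - 2))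
        ≤ ((Δ : ℝ) - 1) ^ (2 : ℝ) := by
          -- At the origin all `Δ` neighbours may be available, outside the range of
          -- `rpow_le_natCast`. The exponent is still at most `(Δ-1)/(Δ-2) ≤ 2`, which is the source
          -- of the factor `(Δ-1)^2`.
          refine Real.rpow_le_rpow_of_exponent_le (by linarith) ?_
          rw [div_le_iff₀ hpos]
          linarith
      _ = ((Δ : ℝ) - 1) ^ 2 * 1 := by norm_num
      _ ≤ _ := mul_le_mul_of_nonneg_left h1 (by positivity)
  | @cons x l h hx ih =>
    have hx' : IsExtendable hconn o (x :: l) := .cons h hx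
    cases l with
    | nil => cases h
    | cons y l =>
      have h1 := rpow_le_natCast hΔ (card_pos.2 hx'.extensions_nonempty)
        (hx'.card_extensions_lt hreg)
      rw [extensionSum, branching, List.length_cons]
      push_cast at ih ⊢
      have h2 : ((#(extensions hconn (x :: y :: l)) : ℝ) + extensionSum hconn (y :: l) -
          ((y :: l).length + 1)) / (Δ - 2) = ((#(extensions hconn (x :: y :: l)) : ℝ) - 1) / (Δ - 2)
          + ((extensionSum hconn (y :: l) : ℝ) - (y :: l).length) / (Δ - 2) := by
        ring
      rw [h2, Real.rpow_add (by linarith)]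
      calc _ ≤ (#(extensions hconn (x :: y :: l)) : ℝ) *
            (((Δ : ℝ) - 1) ^ 2 * branching hconn (y :: l)) :=
            mul_le_mul h1 ih (Real.rpow_nonneg (by linarith) _) (Nat.cast_nonneg _)
        _ = _ := by ring

theorem IsExtendable.exists_isPath {l : List V} (h : IsExtendable hconn o l) :
    ∃ (v : V) (t : List V) (p : G.Walk o v), l = v :: t ∧ p.IsPath ∧ p.support.reverse = l := by
  induction h with
  | single => exact ⟨o, [], Walk.nil, rfl, Walk.IsPath.nil, rfl⟩
  | @cons x l h hx ih =>
    obtain ⟨v, t, p, rfl, hp, hsup⟩ := ih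
    obtain ⟨hvx, hxf⟩ := mem_sdiff.1 hx
    rw [mem_neighborFinset] at hvx
    refine ⟨x, v :: t, p.concat hvx, rfl, hp.concat ?_ hvx, ?_⟩
    · intro hmem
      exact hxf (mem_fillList hconn (hsup ▸ List.mem_reverse.2 hmem))
    · rw [Walk.support_concat]
      simp [hsup]

theorem card_extendableLists_le (n : ℕ) :
    #(extendableLists hconn o n) ≤ G.sawCount o n := by
  have hsub : (extendableLists hconn o n : Set (List V)) ⊆
      (fun p : Σ v : V, G.Walk o v => p.2.support.reverse) '' G.selfAvoidingWalks o n := by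
    intro l hl
    obtain ⟨h, hlen⟩ := isExtendable_of_mem hl
    obtain ⟨v, t, p, -, hp, hsup⟩ := h.exists_isPath
    refine ⟨⟨v, p⟩, ⟨hp, ?_⟩, hsup⟩
    rw [← hsup, List.length_reverse, Walk.length_support] at hlen
    simpa using hlen
  have hfin := G.finite_selfAvoidingWalks o n
  rw [← Set.ncard_coe_finset]
  exact (Set.ncard_le_ncard hsub (hfin.image _)).trans (Set.ncard_image_le hfin)

/-- These are the probabilities of the walks when each step is chosen uniformly among the
extensions. Mass is conserved because extensions always exist; the tail appears because the choices
at the last vertex have not been made yet. -/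
theorem sum_inv_branching_tail (n : ℕ) :
    ∑ l ∈ extendableLists hconn o n, (branching hconn l.tail : ℝ)⁻¹ = 1 := by
  induction n with
  | zero => simp [extendableLists, branching]
  | succ n ih =>
    rw [extendableLists, sum_biUnion, ← ih]
    · refine sum_congr rfl fun l hl => ?_
      rw [sum_image fun x _ y _ h => (List.cons.inj h).1]
      simp only [List.tail_cons, sum_const, nsmul_eq_mul]
      have hext := (isExtendable_of_mem hl).1
      have hpos : (#(extensions hconn l) : ℝ) ≠ 0 := by
        exact_mod_cast (card_pos.2 hext.extensions_nonempty).ne'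
      cases l with
      | nil => cases hext
      | cons x l =>
        rw [branching, List.tail_cons, Nat.cast_mul, mul_inv, mul_inv_cancel_left₀ hpos]
    · intro l _ l' _ hne
      refine Finset.disjoint_left.2 fun a ha ha' => hne ?_
      obtain ⟨x, -, rfl⟩ := mem_image.1 ha
      obtain ⟨y, -, h⟩ := mem_image.1 ha'
      exact (List.cons.inj h).2.symm

theorem tail_mem_extendableLists {n : ℕ} {l : List V}
    (h : l ∈ extendableLists hconn o (n + 1)) : l.tail ∈ extendableLists hconn o n := by
  obtain ⟨l', hl', h⟩ := mem_biUnion.1 h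
  obtain ⟨x, -, rfl⟩ := mem_image.1 h
  exact hl'

theorem IsExtendable.branching_pos {l : List V} (h : IsExtendable hconn o l) :
    0 < branching hconn l := by
  induction h with
  | single =>
    exact Nat.mul_pos (card_pos.2 (IsExtendable.single (hconn := hconn)).extensions_nonempty)
      Nat.one_pos
  | cons h hx ih => exact Nat.mul_pos (card_pos.2 (IsExtendable.cons h hx).extensions_nonempty) ih

theorem rpow_le_sawCount (hconn : G.Connected) (htrans : G.IsVertexTransitive) {Δ : ℕ}
    (hreg : G.IsRegularOfDegree Δ) (hΔ : 3 ≤ Δ) {l : ℝ} (hl : l ∈ G.spectralLowerBounds)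
    (hl0 : 0 ≤ l) (o : V) (n : ℕ) :
    ((Δ : ℝ) - 1) ^
        ((1 + ((Δ : ℝ) * ((Δ : ℝ) - 1) / ((Δ : ℝ) - 2) ^ 2) * l) / 2 * ((n + 1 : ℕ) : ℝ)) ≤
      ((Δ : ℝ) - 1) ^ 2 * G.sawCount o (n + 1) := by
  have hΔ3 : (3 : ℝ) ≤ Δ := by exact_mod_cast hΔ
  have hpos : (0 : ℝ) < Δ - 2 := by linarith
  set M := ((Δ : ℝ) - 1) ^
    ((1 + ((Δ : ℝ) * ((Δ : ℝ) - 1) / ((Δ : ℝ) - 2) ^ 2) * l) / 2 * ((n + 1 : ℕ) : ℝ)) with hM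
  have hMpos : 0 < M := Real.rpow_pos_of_pos (by linarith) _
  have hD : 0 < ((Δ : ℝ) - 1) ^ 2 := pow_pos (by linarith) 2
  have hbound : ∀ t ∈ extendableLists hconn o n, M ≤ ((Δ : ℝ) - 1) ^ 2 * branching hconn t := by
    intro t ht
    obtain ⟨ht, hlen⟩ := isExtendable_of_mem ht
    refine le_trans ?_ (ht.rpow_le_branching hreg hΔ)
    refine Real.rpow_le_rpow_of_exponent_le (by linarith) ?_
    have h1 : (G.cutSize (fillList hconn t) : ℝ) + Δ * t.length ≤ 2 * extensionSum hconn t := by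
      exact_mod_cast ht.cutSize_add_le htrans hreg
    have h2 := G.mul_card_le_cutSize hreg hΔ hl hl0 (fillList hconn t)
    have h3 : (t.length : ℝ) ≤ #(fillList hconn t) := by exact_mod_cast ht.length_le_card
    have h4 : 0 ≤ l * (Δ * (Δ - 1) / (Δ - 2) : ℝ) :=
      mul_nonneg hl0 (div_nonneg (mul_nonneg (by linarith) (by linarith)) hpos.le)
    have h5 := mul_le_mul_of_nonneg_left h3 h4
    rw [le_div_iff₀ hpos, ← hlen]
    have h6 : (1 + ((Δ : ℝ) * ((Δ : ℝ) - 1) / ((Δ : ℝ) - 2) ^ 2) * l) / 2 * (t.length : ℝ) *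
        (Δ - 2) = ((Δ - 2) * t.length + l * (Δ * (Δ - 1) / (Δ - 2)) * t.length) / 2 := by
      field_simp
    rw [h6]
    linarith
  have hcard : (#(extendableLists hconn o (n + 1)) : ℝ) ≤ G.sawCount o (n + 1) := by
    exact_mod_cast card_extendableLists_le (hconn := hconn) (o := o) (n + 1)
  -- The probabilities add up to one and each is at most `(Δ-1)^2 / M`.
  have hone : (1 : ℝ) ≤ #(extendableLists hconn o (n + 1)) * (((Δ : ℝ) - 1) ^ 2 / M) := by
    refine (sum_inv_branching_tail (hconn := hconn) (o := o) (n + 1)).symm.trans_le ?_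
    rw [← nsmul_eq_mul]
    refine sum_le_card_nsmul _ _ _ fun t ht => ?_
    have htail := tail_mem_extendableLists ht
    have hb : (0 : ℝ) < branching hconn t.tail := by
      exact_mod_cast (isExtendable_of_mem htail).1.branching_pos
    rw [inv_eq_one_div, div_le_div_iff₀ hb hMpos, one_mul]
    exact hbound _ htail
  rw [mul_div_assoc', le_div_iff₀ hMpos, one_mul] at hone
  rw [mul_comm]
  exact hone.trans (mul_le_mul_of_nonneg_right hcard hD.le)

end Extendable

end SimpleGraph

end

/-! ### The limit, the criterion for amenability and the main theorem -/

noncomputable section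

namespace SimpleGraph

open Finset Filter Topology

theorem tendsto_log_sawCount_div {V : Type*} (G : SimpleGraph V) [G.LocallyFinite]
    (htrans : G.IsVertexTransitive) {o : V}
    (hpos : ∀ n, 0 < G.sawCount o n) :
    ∃ L, Tendsto (fun n : ℕ => Real.log (G.sawCount o n) / n) atTop (𝓝 L) := by
  have hsub : Subadditive fun n => Real.log (G.sawCount o n) := by
    intro m n
    have hm : (G.sawCount o m : ℝ) ≠ 0 := by exact_mod_cast (hpos m).ne'
    have hn : (G.sawCount o n : ℝ) ≠ 0 := by exact_mod_cast (hpos n).ne'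
    rw [← Real.log_mul hm hn]
    exact Real.log_le_log (by exact_mod_cast hpos _)
      (by exact_mod_cast G.sawCount_add_le htrans o m n)
  refine ⟨hsub.lim, hsub.tendsto_lim ⟨0, ?_⟩⟩
  rintro _ ⟨n, rfl⟩
  exact div_nonneg (Real.log_nonneg (by exact_mod_cast hpos n)) (Nat.cast_nonneg _)

theorem tendsto_sawCount_rpow {V : Type*} (G : SimpleGraph V)
    (o : V) (hpos : ∀ n, 0 < G.sawCount o n) {L : ℝ}
    (hL : Tendsto (fun n : ℕ => Real.log (G.sawCount o n) / n) atTop (𝓝 L)) :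
    Tendsto (fun n : ℕ => (G.sawCount o n : ℝ) ^ (1 / (n : ℝ))) atTop (𝓝 (Real.exp L)) := by
  refine ((Real.continuous_exp.tendsto L).comp hL).congr fun n => ?_
  rw [Real.rpow_def_of_pos (by exact_mod_cast hpos n), mul_one_div]
  rfl

theorem bddBelow_isoperimetric {V : Type*} (G : SimpleGraph V)
    (Δ : ℕ) :
    BddBelow (Set.range fun W : {W : Finset V // W.Nonempty} =>
      ((G.edgesToCompl (W.1 : Set V)).ncard : ℝ) / ((Δ : ℝ) * (W.1.card : ℝ))) := by
  refine ⟨0, ?_⟩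
  rintro _ ⟨W, rfl⟩
  positivity

theorem edgeIsoperimetricConstant_nonneg {V : Type*} (G : SimpleGraph V)
    (Δ : ℕ) : 0 ≤ G.edgeIsoperimetricConstant Δ :=
  Real.iInf_nonneg fun W => by positivity

theorem edgeIsoperimetricConstant_mul_le {V : Type*} [DecidableEq V] (G : SimpleGraph V)
    [G.LocallyFinite] {Δ : ℕ} (hΔ : 0 < Δ) (W : Finset V) (hW : W.Nonempty) :
    G.edgeIsoperimetricConstant Δ * (Δ * #W) ≤ G.cutSize W := by
  have hcard : (0 : ℝ) < #W := by exact_mod_cast card_pos.2 hW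
  have hΔ' : (0 : ℝ) < Δ := by exact_mod_cast hΔ
  rw [← le_div_iff₀ (mul_pos hΔ' hcard), ← ncard_edgesToCompl]
  exact ciInf_le (G.bddBelow_isoperimetric Δ) ⟨W, hW⟩

variable {V : Type*} [DecidableEq V] [Infinite V] (G : SimpleGraph V) [G.LocallyFinite]

/-- The spectral bottom of a regular graph is positive exactly if the graph is non-amenable. -/
theorem spectralBottom_pos_iff {Δ : ℕ} (hreg : G.IsRegularOfDegree Δ) (hΔ : 3 ≤ Δ)
    (hbot : IsGreatest G.spectralLowerBounds G.spectralBottom) :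
    0 < G.spectralBottom ↔ ¬ G.IsAmenableOfDegree Δ := by
  have hΔ3 : (3 : ℝ) ≤ Δ := by exact_mod_cast hΔ
  have hΔ0 : 0 < Δ := by omega
  constructor
  · intro h
    -- This is `mul_card_le_cutSize` divided by `Δ |W|`; the converse direction below is Cheeger's
    -- inequality.
    suffices hle : G.spectralBottom * ((Δ - 1) / (Δ - 2)) ≤ G.edgeIsoperimetricConstant Δ by
      refine ne_of_gt (lt_of_lt_of_le (mul_pos h (div_pos ?_ ?_)) hle) <;> linarith
    have : Nonempty {W : Finset V // W.Nonempty} :=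
      ⟨⟨{Classical.arbitrary V}, singleton_nonempty _⟩⟩
    refine le_ciInf fun W => ?_
    have hcard : (0 : ℝ) < #W.1 := by exact_mod_cast card_pos.2 W.2
    rw [le_div_iff₀ (by positivity), ncard_edgesToCompl]
    refine le_trans (le_of_eq ?_) (G.mul_card_le_cutSize hreg hΔ hbot.1 h.le W.1)
    ring
  · intro h
    have hφ : 0 < G.edgeIsoperimetricConstant Δ :=
      lt_of_le_of_ne (G.edgeIsoperimetricConstant_nonneg Δ) (Ne.symm h)
    have hmem := G.sq_div_two_mem_spectralLowerBounds hreg hΔ0.ne' hφ.le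
      (G.edgeIsoperimetricConstant_mul_le hΔ0)
    exact lt_of_lt_of_le (by positivity) (hbot.2 hmem)

end SimpleGraph

end

theorem mainTheorem3 {V : Type*} [Infinite V] (G : SimpleGraph V) [G.LocallyFinite]
    (hconn : G.Connected) (htrans : G.IsVertexTransitive)
    (Δ : ℕ) (hreg : G.IsRegularOfDegree Δ) (hΔ : 3 ≤ Δ) (o : V) :
    -- the connective constant exists as a limit
    Filter.Tendsto (fun n : ℕ => (G.sawCount o n : ℝ) ^ (1 / (n : ℝ)))
      Filter.atTop (nhds (G.connectiveConstant o)) ∧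
    -- the spectral bottom is attained as a maximum
    IsGreatest G.spectralLowerBounds G.spectralBottom ∧
    -- the lower bound for the connective constant
    ((Δ : ℝ) - 1) ^
        ((1 + ((Δ : ℝ) * ((Δ : ℝ) - 1) / ((Δ : ℝ) - 2) ^ 2) * G.spectralBottom) / 2)
      ≤ G.connectiveConstant o ∧
    -- the bound is strictly better than `√(Δ - 1)` exactly for non-amenable graphs
    (Real.sqrt ((Δ : ℝ) - 1) <
        ((Δ : ℝ) - 1) ^
          ((1 + ((Δ : ℝ) * ((Δ : ℝ) - 1) / ((Δ : ℝ) - 2) ^ 2) * G.spectralBottom) / 2)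
      ↔ ¬ G.IsAmenableOfDegree Δ) := by
  classical
  have hΔ3 : (3 : ℝ) ≤ Δ := by exact_mod_cast hΔ
  have hD : (1 : ℝ) < (Δ : ℝ) - 1 := by linarith
  have hmem := G.sq_div_two_mem_spectralLowerBounds hreg (by omega)
    (G.edgeIsoperimetricConstant_nonneg Δ) (G.edgeIsoperimetricConstant_mul_le (by omega))
  have hbot := G.isGreatest_spectralBottom ⟨_, hmem⟩
  have hbot0 : 0 ≤ G.spectralBottom := le_trans (by positivity) (hbot.2 hmem)
  set e := (1 + ((Δ : ℝ) * ((Δ : ℝ) - 1) / ((Δ : ℝ) - 2) ^ 2) * G.spectralBottom) / 2 with he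
  have hlower : ∀ n : ℕ, ((Δ : ℝ) - 1) ^ (e * ((n + 1 : ℕ) : ℝ)) ≤
      ((Δ : ℝ) - 1) ^ 2 * G.sawCount o (n + 1) := fun n =>
    SimpleGraph.rpow_le_sawCount hconn htrans hreg hΔ hbot.1 hbot0 o n
  -- Positivity of the counts, needed to take logarithms, already follows from the lower bound.
  have hpos_succ : ∀ n, 0 < G.sawCount o (n + 1) := by
    intro n
    by_contra h
    have h0 : G.sawCount o (n + 1) = 0 := by omega
    have h1 := hlower n
    rw [h0, Nat.cast_zero, mul_zero] at h1
    exact absurd (Real.rpow_pos_of_pos (by linarith) _) h1.not_gt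
  have hpos : ∀ n, 0 < G.sawCount o n := by
    rintro (_ | n)
    · have := G.sawCount_add_le htrans o 0 1
      exact Nat.pos_of_mul_pos_right ((hpos_succ 0).trans_le (by simpa using this))
    · exact hpos_succ n
  obtain ⟨L, hL⟩ := G.tendsto_log_sawCount_div htrans hpos
  have hlim := G.tendsto_sawCount_rpow o hpos hL
  have hcc : G.connectiveConstant o = Real.exp L := hlim.limUnder_eq
  refine ⟨hcc ▸ hlim, hbot, ?_, ?_⟩
  · rw [hcc, Real.rpow_def_of_pos (by linarith), Real.exp_le_exp]
    -- After logarithms are taken and divided by `n`, the constant factor `(Δ-1)^2` contributes only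
    -- a vanishing term.
    have hlim' : Filter.Tendsto (fun n : ℕ => Real.log ((Δ : ℝ) - 1) * e -
        2 * Real.log ((Δ : ℝ) - 1) / n) Filter.atTop (nhds (Real.log ((Δ : ℝ) - 1) * e - 0)) :=
      tendsto_const_nhds.sub (tendsto_const_div_atTop_nhds_zero_nat _)
    rw [sub_zero] at hlim'
    refine le_of_tendsto_of_tendsto hlim' hL ?_
    filter_upwards [Filter.eventually_ge_atTop 1] with n hn
    obtain ⟨n, rfl⟩ : ∃ k, n = k + 1 := ⟨n - 1, by omega⟩
    have hσ : (0 : ℝ) < G.sawCount o (n + 1) := by exact_mod_cast hpos _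
    have h1 := Real.log_le_log (Real.rpow_pos_of_pos (by linarith) _) (hlower n)
    rw [Real.log_rpow (by linarith), Real.log_mul (by positivity) hσ.ne', Real.log_pow] at h1
    have hn' : (0 : ℝ) < ((n + 1 : ℕ) : ℝ) := by positivity
    rw [le_div_iff₀ hn', sub_mul, div_mul_cancel₀ _ hn'.ne']
    push_cast at h1 ⊢
    linarith
  · rw [← G.spectralBottom_pos_iff hreg hΔ hbot, Real.sqrt_eq_rpow,
      Real.rpow_lt_rpow_left_iff hD, he, div_lt_div_iff_of_pos_right two_pos, lt_add_iff_pos_right]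
    refine mul_pos_iff_of_pos_left (div_pos (mul_pos ?_ ?_) (pow_pos ?_ 2)) <;> linarith
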